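/- Let $n$ be a positive integer, $A_n=\mathbb{C}[t_1,\dots,t_n]$, and let $W_n=\mathrm{Der}(A_n)$ be the Witt algebra, with $\partial_i=\partial/\partial t_i$ and $h_i=t_i\partial_i$ for $i=1,\dots,n$. Put $\Delta_n=\mathrm{Span}\{\partial_1,\dots,\partial_n\}$ and $\mathfrak{h}_n=\mathrm{Span}\{h_1,\dots,h_n\}$. Let $U_\partial$ be the localization of the universal enveloping algebra $U(W_n)$ at the Ore set $\{\partial_1^{i_1}\cdots\partial_n^{i_n}\mid i_1,\dots,i_n\in\mathbb{Z}_{\ge 0}\}$, and let $$H_n=\{u\in U_\partial\mid [u,\partial_i]=[u,h_i]=0 \text{ for all } i=1,\dots,n\}$$ be the centralizer of $\mathfrak{h}_n\oplus\Delta_n$ in $U_\partial$. Let $\mathbb{C}_{\mathbf 1}$ be the one-dimensional $U(\Delta_n)$-module on which every $\partial_i$ acts as the identity, and let $Q_{\mathbf 1}=U(W_n)\otimes_{U(\Delta_n)}\mathbb{C}_{\mathbf 1}$ be the universal Whittaker module. Then there is an isomorphism of associative $\mathbb{C}$-algebras $$H_n\cong \mathrm{End}_{W_n}(Q_{\mathbf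 1})^{\mathrm{op}}.$$ -/

import Mathlib

noncomputable section

namespace WittWhittaker

open TensorProduct

attribute [local instance] LieRing.ofAssociativeRing

/-- The polynomial algebra `A_n = ℂ[t_1, …, t_n]`. -/
abbrev A (n : ℕ) : Type := MvPolynomial (Fin n) ℂ

/-- The Witt algebra `W_n = Der(A_n)`, with the commutator bracket of derivations. -/
def WittAlg (n : ℕ) : Type := Derivation ℂ (A n) (A n)

instance (n : ℕ) : LieRing (WittAlg n) := inferInstanceAs (LieRing (Derivation ℂ (A n) (A n)))

instance (n : ℕ) : LieAlgebra ℂ (WittAlg n) :=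
  inferInstanceAs (LieAlgebra ℂ (Derivation ℂ (A n) (A n)))

/-- The identity map, reading an element of `W_n` as a derivation of `A_n`. -/
def toDer {n : ℕ} : WittAlg n ≃ₗ[ℂ] Derivation ℂ (A n) (A n) where
  toFun D := D
  invFun D := D
  map_add' _ _ := rfl
  map_smul' _ _ := rfl
  left_inv _ := rfl
  right_inv _ := rfl

/-- The bracket of `W_n` is the commutator of derivations. -/
theorem toDer_lie {n : ℕ} (D E : WittAlg n) (f : A n) :
    toDer ⁅D, E⁆ f = toDer D (toDer E f) - toDer E (toDer D f) :=
  Derivation.commutator_apply (D1 := toDer D) (D2 := toDer E) f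

theorem WittAlg.ext {n : ℕ} {D E : WittAlg n}
    (h : ∀ i : Fin n, toDer D (MvPolynomial.X i) = toDer E (MvPolynomial.X i)) : D = E :=
  toDer.injective (MvPolynomial.derivation_ext h)

/-- The partial derivative `∂_i` as an element of `W_n`. -/
def partialW {n : ℕ} (i : Fin n) : WittAlg n := toDer.symm (MvPolynomial.pderiv i)

/-- `h_i = t_i ∂_i`. -/
def eulerW {n : ℕ} (i : Fin n) : WittAlg n :=
  toDer.symm ((MvPolynomial.X i : A n) • MvPolynomial.pderiv i)

theorem toDer_partialW {n : ℕ} (i : Fin n) :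
    toDer (partialW i : WittAlg n) = MvPolynomial.pderiv i := rfl

theorem apply_partialW_X {n : ℕ} (D : WittAlg n) (i j : Fin n) :
    toDer D (toDer (partialW i : WittAlg n) (MvPolynomial.X j)) = 0 := by
  rw [toDer_partialW]
  rcases eq_or_ne j i with rfl | h
  · rw [MvPolynomial.pderiv_X_self, Derivation.map_one_eq_zero]
  · rw [MvPolynomial.pderiv_X_of_ne h, map_zero]

theorem partialW_lie {n : ℕ} (i j : Fin n) : ⁅(partialW i : WittAlg n), partialW j⁆ = 0 :=
  WittAlg.ext fun k => by
    rw [toDer_lie, apply_partialW_X, apply_partialW_X, sub_zero, map_zero, Derivation.coe_zero,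
      Pi.zero_apply]

theorem lie_eq_zero_of_mem_span {n : ℕ} {x y : WittAlg n}
    (hx : x ∈ Submodule.span ℂ (Set.range (partialW : Fin n → WittAlg n)))
    (hy : y ∈ Submodule.span ℂ (Set.range (partialW : Fin n → WittAlg n))) : ⁅x, y⁆ = 0 := by
  induction hx using Submodule.span_induction with
  | mem x hx =>
    obtain ⟨i, rfl⟩ := hx
    induction hy using Submodule.span_induction with
    | mem y hy => obtain ⟨j, rfl⟩ := hy; exact partialW_lie i j
    | zero => simp
    | add a b _ _ ha hb => rw [lie_add, ha, hb, add_zero]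
    | smul c a _ ha => rw [lie_smul, ha, smul_zero]
  | zero => simp
  | add a b _ _ ha hb => rw [add_lie, ha, hb, add_zero]
  | smul c a _ ha => rw [smul_lie, ha, smul_zero]

/-- The abelian subalgebra `Δ_n = Span{∂_1, …, ∂_n}` of `W_n`. -/
def Delta (n : ℕ) : LieSubalgebra ℂ (WittAlg n) where
  __ := Submodule.span ℂ (Set.range (partialW : Fin n → WittAlg n))
  lie_mem' := by
    intro x y hx hy
    have h : ⁅x, y⁆ = 0 := lie_eq_zero_of_mem_span hx hy
    rw [h]
    exact Submodule.zero_mem _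

theorem partialW_mem_Delta {n : ℕ} (i : Fin n) : (partialW i : WittAlg n) ∈ Delta n :=
  Submodule.subset_span (Set.mem_range_self i)

/-- The universal enveloping algebra `U = U(W_n)`. -/
abbrev U (n : ℕ) : Type := UniversalEnvelopingAlgebra ℂ (WittAlg n)

/-- The universal enveloping algebra `U(Δ_n)`. -/
abbrev UDelta (n : ℕ) : Type := UniversalEnvelopingAlgebra ℂ (Delta n)

/-- The canonical algebra homomorphism `U(Δ_n) → U(W_n)` induced by the inclusion. -/
def inclU (n : ℕ) : UDelta n →ₐ[ℂ] U n :=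
  UniversalEnvelopingAlgebra.lift ℂ
    ((UniversalEnvelopingAlgebra.ι ℂ (L := WittAlg n)).comp (Delta n).incl)

/-- `∂_i` as an element of `U(W_n)`. -/
def partialU {n : ℕ} (i : Fin n) : U n := UniversalEnvelopingAlgebra.ι ℂ (partialW i)

/-- `h_i` as an element of `U(W_n)`. -/
def eulerU {n : ℕ} (i : Fin n) : U n := UniversalEnvelopingAlgebra.ι ℂ (eulerW i)

/-! ### The localization `U_∂` -/

/-- The multiplicative subset of `U(W_n)` generated by `∂_1, …, ∂_n`. As the `∂_i` commute, it is
the set of the monomials in them. -/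
def partialMonoid (n : ℕ) : Submonoid (U n) := Submonoid.closure (Set.range partialU)

section Ore

variable {R : Type*} [Ring R]

/-- The additive map `[p, -]` on a ring. -/
def adMap (p : R) : R →+ R := AddMonoidHom.mulLeft p - AddMonoidHom.mulRight p

theorem adMap_apply (p x : R) : adMap p x = p * x - x * p := rfl

theorem adMap_mul (p x y : R) : adMap p (x * y) = adMap p x * y + x * adMap p y := by
  simp only [adMap_apply]; noncomm_ring

theorem adMap_iterate_mul_eq_zero (p : R) (m : ℕ) : ∀ (a b : ℕ) (x y : R), a + b = m →
    (adMap p)^[a] x = 0 → (adMap p)^[b] y = 0 → (adMap p)^[m] (x * y) = 0 := by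
  induction m with
  | zero =>
    intro a b x y h hx _
    obtain rfl : a = 0 := by omega
    simp only [Function.iterate_zero, id] at hx ⊢
    rw [hx, zero_mul]
  | succ m ih =>
    intro a b x y h hx hy
    rcases a with _ | a
    · simp only [Function.iterate_zero, id] at hx
      rw [hx, zero_mul, iterate_map_zero]
    rcases b with _ | b
    · simp only [Function.iterate_zero, id] at hy
      rw [hy, mul_zero, iterate_map_zero]
    rw [Function.iterate_succ_apply, adMap_mul, iterate_map_add,
      ih a (b + 1) (adMap p x) y (by omega) (by rwa [Function.iterate_succ_apply] at hx) hy,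
      ih (a + 1) b x (adMap p y) (by omega) hx (by rwa [Function.iterate_succ_apply] at hy),
      add_zero]

/-- If `(ad p)^k r = 0`, then `p^k r ∈ R p`. -/
theorem exists_pow_mul_eq (p : R) (k : ℕ) : ∀ r : R, (adMap p)^[k] r = 0 →
    ∃ v : R, p ^ k * r = v * p := by
  induction k with
  | zero => intro r hr; exact ⟨0, by simpa using hr⟩
  | succ k ih =>
    intro r hr
    obtain ⟨v, hv⟩ := ih (adMap p r) (by rwa [Function.iterate_succ_apply] at hr)
    refine ⟨v + p ^ k * r, ?_⟩
    rw [add_mul, ← hv, adMap_apply, pow_succ]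
    noncomm_ring

theorem pow_mul_eq_zero (p : R) (k : ℕ) : ∀ r : R, (adMap p)^[k] r = 0 → r * p = 0 →
    p ^ k * r = 0 := by
  induction k with
  | zero => intro r hr _; simpa using hr
  | succ k ih =>
    intro r hr h0
    have h1 : adMap p r = p * r := by rw [adMap_apply, h0, sub_zero]
    have h2 := ih (adMap p r) (by rwa [Function.iterate_succ_apply] at hr)
      (by rw [h1, mul_assoc, h0, mul_zero])
    rw [pow_succ, mul_assoc, ← h1, h2]

/-- The multiplicative set generated by locally ad-nilpotent elements is a left Ore set. -/
theorem ore_of_ad_nilpotent (T : Set R) (hT : ∀ p ∈ T, ∀ r : R, ∃ k, (adMap p)^[k] r = 0) :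
    (∀ s ∈ Submonoid.closure T, ∀ r : R, r * s = 0 → ∃ u ∈ Submonoid.closure T, u * r = 0) ∧
    (∀ s ∈ Submonoid.closure T, ∀ r : R, ∃ u ∈ Submonoid.closure T, ∃ v : R, u * r = v * s) := by
  constructor
  · intro s hs
    induction hs using Submonoid.closure_induction with
    | mem p hp =>
      intro r hr
      obtain ⟨k, hk⟩ := hT p hp r
      exact ⟨p ^ k, pow_mem (Submonoid.subset_closure hp) k, pow_mul_eq_zero p k r hk hr⟩
    | one => intro r hr; exact ⟨1, one_mem _, by simpa using hr⟩
    | mul x y _ _ hx hy =>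
      intro r hr
      obtain ⟨u, hu, h1⟩ := hy (r * x) (by rw [mul_assoc, hr])
      obtain ⟨w, hw, h2⟩ := hx (u * r) (by rw [mul_assoc, h1])
      exact ⟨w * u, mul_mem hw hu, by rw [mul_assoc, h2]⟩
  · intro s hs
    induction hs using Submonoid.closure_induction with
    | mem p hp =>
      intro r
      obtain ⟨k, hk⟩ := hT p hp r
      exact ⟨p ^ k, pow_mem (Submonoid.subset_closure hp) k, exists_pow_mul_eq p k r hk⟩
    | one => intro r; exact ⟨1, one_mem _, r, by simp⟩
    | mul x y _ _ hx hy =>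
      intro r
      obtain ⟨u, hu, v, h1⟩ := hy r
      obtain ⟨w, hw, v', h2⟩ := hx v
      exact ⟨w * u, mul_mem hw hu, v', by rw [mul_assoc, h1, ← mul_assoc, h2, mul_assoc]⟩

end Ore

theorem pderiv_iterate_eq_zero {n : ℕ} (i : Fin n) (f : A n) :
    ∃ k, ∀ m, k ≤ m → (MvPolynomial.pderiv i : Derivation ℂ (A n) (A n))^[m] f = 0 := by
  have key : ∀ m, ∀ s : Fin n →₀ ℕ, ∀ a : ℂ, s i < m →
      (MvPolynomial.pderiv i : Derivation ℂ (A n) (A n))^[m] (MvPolynomial.monomial s a) = 0 := by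
    intro m
    induction m with
    | zero => intro s a h; omega
    | succ m ih =>
      intro s a h
      rw [Function.iterate_succ_apply, MvPolynomial.pderiv_monomial]
      by_cases h0 : s i = 0
      · rw [h0, Nat.cast_zero, mul_zero, MvPolynomial.monomial_zero, iterate_map_zero]
      · apply ih
        rw [Finsupp.tsub_apply, Finsupp.single_eq_same]
        omega
  induction f using MvPolynomial.induction_on' with
  | monomial s a => exact ⟨s i + 1, fun m hm => key m s a hm⟩
  | add f g hf hg =>
    obtain ⟨k, hk⟩ := hf
    obtain ⟨l, hl⟩ := hg
    refine ⟨max k l, fun m hm => ?_⟩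
    rw [iterate_map_add, hk m (le_of_max_le_left hm), hl m (le_of_max_le_right hm), add_zero]

/-- `ad ∂_i` is locally nilpotent on `W_n`. -/
theorem ad_partialW_nilpotent {n : ℕ} (i : Fin n) (D : WittAlg n) :
    ∃ k, (fun E : WittAlg n => ⁅partialW i, E⁆)^[k] D = 0 := by
  have h : ∀ (m : ℕ) (E : WittAlg n) (j : Fin n),
      toDer ((fun E : WittAlg n => ⁅partialW i, E⁆)^[m] E) (MvPolynomial.X j) =
        (MvPolynomial.pderiv i : Derivation ℂ (A n) (A n))^[m] (toDer E (MvPolynomial.X j)) := by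
    intro m
    induction m with
    | zero => intro E j; rfl
    | succ m ih =>
      intro E j
      rw [Function.iterate_succ_apply, ih, Function.iterate_succ_apply, toDer_lie,
        apply_partialW_X, sub_zero, toDer_partialW]
  choose k hk using fun j : Fin n => pderiv_iterate_eq_zero i (toDer D (MvPolynomial.X j))
  refine ⟨Finset.univ.sup k, WittAlg.ext fun j => ?_⟩
  rw [h, hk j _ (Finset.le_sup (Finset.mem_univ j)), map_zero, Derivation.coe_zero, Pi.zero_apply]

/-- `ad ∂_i` is locally nilpotent on `U(W_n)`. -/
theorem ad_partialU_nilpotent {n : ℕ} (i : Fin n) (r : U n) :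
    ∃ k, (adMap (partialU i))^[k] r = 0 := by
  have hadd : ∀ x y : U n, (∃ k, (adMap (partialU i))^[k] x = 0) →
      (∃ k, (adMap (partialU i))^[k] y = 0) → ∃ k, (adMap (partialU i))^[k] (x + y) = 0 := by
    rintro x y ⟨k, hk⟩ ⟨l, hl⟩
    refine ⟨k + l, ?_⟩
    rw [iterate_map_add, Function.iterate_add_apply _ k l y, hl, iterate_map_zero, add_comm k l,
      Function.iterate_add_apply, hk, iterate_map_zero, add_zero]
  let N : Subalgebra ℂ (U n) :=
    { carrier := {x | ∃ k, (adMap (partialU i))^[k] x = 0}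
      mul_mem' := by
        rintro x y ⟨k, hk⟩ ⟨l, hl⟩
        exact ⟨k + l, adMap_iterate_mul_eq_zero _ _ k l x y rfl hk hl⟩
      add_mem' := fun {x y} hx hy => hadd x y hx hy
      algebraMap_mem' := by
        intro c
        refine ⟨1, ?_⟩
        rw [Function.iterate_one, adMap_apply, Algebra.commutes, sub_self] }
  have hι : ∀ (m : ℕ) (D : WittAlg n), (adMap (partialU i))^[m] (UniversalEnvelopingAlgebra.ι ℂ D) =
      UniversalEnvelopingAlgebra.ι ℂ ((fun E : WittAlg n => ⁅partialW i, E⁆)^[m] D) := by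
    intro m
    induction m with
    | zero => intro D; rfl
    | succ m ih =>
      intro D
      rw [Function.iterate_succ_apply, Function.iterate_succ_apply, ← ih, LieHom.map_lie]
      rfl
  have hN : ∀ D : WittAlg n, UniversalEnvelopingAlgebra.ι ℂ D ∈ N := by
    intro D
    obtain ⟨k, hk⟩ := ad_partialW_nilpotent i D
    exact ⟨k, by rw [hι, hk, map_zero]⟩
  let f : WittAlg n →ₗ⁅ℂ⁆ N :=
    { toFun := fun D => ⟨UniversalEnvelopingAlgebra.ι ℂ D, hN D⟩
      map_add' := fun x y => Subtype.ext (map_add _ x y)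
      map_smul' := fun c x => Subtype.ext (map_smul _ c x)
      map_lie' := fun {x y} => Subtype.ext (LieHom.map_lie _ x y) }
  have hf : N.val.comp (UniversalEnvelopingAlgebra.lift ℂ f) = AlgHom.id ℂ (U n) := by
    apply UniversalEnvelopingAlgebra.hom_ext
    ext D
    change ((UniversalEnvelopingAlgebra.lift ℂ f (UniversalEnvelopingAlgebra.ι ℂ D) : N) : U n)
      = UniversalEnvelopingAlgebra.ι ℂ D
    rw [UniversalEnvelopingAlgebra.lift_ι_apply]
    rfl
  have := (UniversalEnvelopingAlgebra.lift ℂ f r).2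
  rwa [show ((UniversalEnvelopingAlgebra.lift ℂ f r : N) : U n) = r from
    DFunLike.congr_fun hf r] at this

theorem partialMonoid_ore (n : ℕ) :
    (∀ s ∈ partialMonoid n, ∀ r : U n, r * s = 0 → ∃ u ∈ partialMonoid n, u * r = 0) ∧
    (∀ s ∈ partialMonoid n, ∀ r : U n, ∃ u ∈ partialMonoid n, ∃ v : U n, u * r = v * s) :=
  ore_of_ad_nilpotent _ (by rintro _ ⟨i, rfl⟩ r; exact ad_partialU_nilpotent i r)

theorem partialMonoid_ore' {n : ℕ} (r : U n) (s : partialMonoid n) :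
    ∃ x : U n × partialMonoid n, (x.2 : U n) * r = x.1 * s := by
  obtain ⟨u, hu, v, h⟩ := (partialMonoid_ore n).2 s s.2 r
  exact ⟨(v, ⟨u, hu⟩), h⟩

/-- The monomials in the `∂_i` form an Ore set in `U(W_n)`. -/
instance partialMonoidOreSet (n : ℕ) : OreLocalization.OreSet (partialMonoid n) where
  ore_right_cancel := by
    intro r₁ r₂ s h
    obtain ⟨u, hu, h'⟩ := (partialMonoid_ore n).1 s s.2 (r₁ - r₂) (by rw [sub_mul, h, sub_self])
    exact ⟨⟨u, hu⟩, by rwa [mul_sub, sub_eq_zero] at h'⟩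
  oreNum r s := (partialMonoid_ore' r s).choose.1
  oreDenom r s := (partialMonoid_ore' r s).choose.2
  ore_eq r s := (partialMonoid_ore' r s).choose_spec

/-- The localization `U_∂` of `U(W_n)` at the Ore set of the monomials in the `∂_i`. -/
abbrev ULoc (n : ℕ) : Type := OreLocalization (partialMonoid n) (U n)

/-- The localization homomorphism `U → U_∂`. -/
def toULoc (n : ℕ) : U n →+* ULoc n := OreLocalization.numeratorRingHom

/-- `H_n = {u ∈ U_∂ | [u, ∂_i] = [u, h_i] = 0 for all i}`, the centralizer of `𝔥_n ⊕ Δ_n`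
in `U_∂`. -/
def H (n : ℕ) : Subalgebra ℂ (ULoc n) :=
  Subalgebra.centralizer ℂ
    (Set.range (fun i : Fin n => toULoc n (partialU i)) ∪
      Set.range (fun i : Fin n => toULoc n (eulerU i)))

/-! ### The universal Whittaker module -/

/-- The Lie character `Δ_n → ℂ` with `∂_i ↦ 1` for all `i`: an element `D = ∑ c_i ∂_i` of `Δ_n` is
sent to `∑ c_i`, and `c_i` is the constant coefficient of `D t_i`. -/
def charOne (n : ℕ) : Delta n →ₗ⁅ℂ⁆ ℂ where
  toFun D := ∑ i : Fin n, MvPolynomial.constantCoeff (toDer (D : WittAlg n) (MvPolynomial.X i))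
  map_add' x y := by simp [Finset.sum_add_distrib]
  map_smul' c x := by simp [Finset.mul_sum, MvPolynomial.smul_eq_C_mul]
  map_lie' := by
    intro x y
    have h : ((⁅x, y⁆ : Delta n) : WittAlg n) = 0 := by
      rw [LieSubalgebra.coe_bracket]
      exact lie_eq_zero_of_mem_span x.2 y.2
    simp [h, LieRing.of_associative_ring_bracket, mul_comm]

theorem charOne_partialW {n : ℕ} (i : Fin n) :
    charOne n ⟨partialW i, partialW_mem_Delta i⟩ = 1 := by
  classical
  change ∑ j : Fin n, MvPolynomial.constantCoeff (toDer (partialW i : WittAlg n) (MvPolynomial.X j)) = 1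
  rw [Finset.sum_eq_single i]
  · simp [toDer_partialW]
  · intro j _ hj
    simp [toDer_partialW, MvPolynomial.pderiv_X_of_ne hj]
  · simp

/-- The underlying space of the one-dimensional `U(Δ_n)`-module `ℂ_𝟏`. -/
def COne (_n : ℕ) : Type := ℂ

instance (n : ℕ) : AddCommGroup (COne n) := inferInstanceAs (AddCommGroup ℂ)

instance (n : ℕ) : Module ℂ (COne n) := inferInstanceAs (Module ℂ ℂ)

/-- `U(Δ_n)` acts on `ℂ_𝟏` through the character `∂_i ↦ 1`. -/
instance (n : ℕ) : Module (UDelta n) (COne n) :=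
  Module.compHom ℂ (UniversalEnvelopingAlgebra.lift ℂ (charOne n)).toRingHom

/-- For an algebra homomorphism `φ : S → B` and a left `S`-module `V`, the `B`-submodule of
`B ⊗_ℂ V` generated by the balancing relations `b φ(a) ⊗ v - b ⊗ a v`. -/
def balanced {S B : Type} (V : Type) [Ring S] [Algebra ℂ S] [Ring B] [Algebra ℂ B]
    (φ : S →ₐ[ℂ] B) [AddCommGroup V] [Module ℂ V] [Module S V] : Submodule B (B ⊗[ℂ] V) :=
  Submodule.span B {x | ∃ (b : B) (a : S) (v : V), x = (b * φ a) ⊗ₜ[ℂ] v - b ⊗ₜ[ℂ] (a • v)}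

/-- The universal Whittaker module `Q_𝟏 = U(W_n) ⊗_{U(Δ_n)} ℂ_𝟏`, a left `U(W_n)`-module. -/
abbrev Q (n : ℕ) : Type := (U n ⊗[ℂ] COne n) ⧸ balanced (COne n) (inclU n)

end WittWhittaker

end

/-!
The isomorphism is `u ↦ (right multiplication by u)`. As `ad ∂_i` is locally nilpotent on `U(W_n)`,
so is `∂_i - 1` on `Q_𝟏`; hence `∂_i` is invertible on `Q_𝟏` (`bijective_partialU_smul`), and `Q_𝟏`
is a module over `U_∂` (`moduleULocQ`). Write `v = 1 ⊗ 1`. As `Q_𝟏` is the free `U(W_n)`-module on a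
vector fixed by the `∂_i` (`exists_hom_genQ`), `φ ↦ φ v` identifies `End(Q_𝟏)` with the space of
Whittaker vectors, the `w` with `∂_i w = w`. An element `u` of `H_n` commutes with the `∂_i`, so `u v`
is a Whittaker vector, and right multiplication reverses products. It has to be shown that `u ↦ u v` is
a bijection from `H_n` to the Whittaker vectors.

Two constructions in `U_∂` do this.

* The weights of `ad h_i` on `U_∂` are integers and their weight spaces span it, and `∂_i` is a unit
  of weight `-1`. So there is a projection of `U_∂` onto the centralizer of the `h_i`, which
  multiplies a vector of weight `(m_1, …, m_n)` by `∂_1^{m_1} ⋯ ∂_n^{m_n}` on the right. It does not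
  see right multiplication by `∂_i`, so it kills the left ideal of the `∂_i - 1`, and it does not
  change the vector `x v` (`exists_twistedProj_family`, `exists_proj_H`).
* `y_i = h_i ∂_i⁻¹` satisfies `[∂_i, y_j] = δ_ij`. If `x v` is a Whittaker vector then
  `y_i [∂_i, x] v = 0`, so multiples of `y_i [∂_i, x]` may be subtracted from `x` until it commutes
  with all the `∂_i` (`exists_forall_commute_smul_eq`).

Injectivity (`eq_zero_of_smul_genQ`): if `u v = 0`, write `s u = r` with `s` a monomial in the `∂_i`
and `r` in `U(W_n)`. Then `r v = 0`, so `r` lies in the left ideal of the `∂_i - 1`, and the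
projection kills `r = u s`; but it maps `u s` to `u`. Surjectivity (`exists_mem_H_smul_genQ`): write
a Whittaker vector as `x v`, make `x` commute with the `∂_i`, and project. The
Poincaré–Birkhoff–Witt theorem is not needed.
-/

noncomputable section

namespace WittWhittaker

open TensorProduct

attribute [local instance] LieRing.ofAssociativeRing

/-! ### Weights of an inner derivation and the twisted projection -/

section Weight

variable {K R : Type*} [Field K] [Ring R] [Algebra K R]

/-- The space of elements of weight `m` for `ad h`, that is, of the `x` with `[h, x] = m x`. -/
def weightSpace (K : Type*) [Field K] [Algebra K R] (h : R) (m : ℤ) : Submodule K R :=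
  Module.End.eigenspace (LinearMap.mulLeft K h - LinearMap.mulRight K h) (m : K)

theorem mem_weightSpace {h x : R} {m : ℤ} :
    x ∈ weightSpace K h m ↔ h * x - x * h = (m : K) • x := by
  rw [weightSpace, Module.End.mem_eigenspace_iff]; rfl

theorem mem_weightSpace_zero {h x : R} : x ∈ weightSpace K h 0 ↔ Commute h x := by
  rw [mem_weightSpace, Int.cast_zero, zero_smul, sub_eq_zero]; rfl

theorem mul_mem_weightSpace {h x y : R} {a b : ℤ} (hx : x ∈ weightSpace K h a)
    (hy : y ∈ weightSpace K h b) : x * y ∈ weightSpace K h (a + b) := by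
  rw [mem_weightSpace] at *
  calc h * (x * y) - x * y * h = (h * x - x * h) * y + x * (h * y - y * h) := by noncomm_ring
    _ = _ := by rw [hx, hy, smul_mul_assoc, mul_smul_comm, ← add_smul, Int.cast_add]

theorem inv_mem_weightSpace {h : R} {p : Rˣ} {a : ℤ} (hp : (p : R) ∈ weightSpace K h a) :
    ((p⁻¹ : Rˣ) : R) ∈ weightSpace K h (-a) := by
  rw [mem_weightSpace] at *
  have e : h * ((p⁻¹ : Rˣ) : R) - (p⁻¹ : Rˣ) * h
      = -((p⁻¹ : Rˣ) * (h * (p : R) - p * h) * (p⁻¹ : Rˣ)) := by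
    rw [mul_sub, sub_mul]
    simp [mul_assoc]
  rw [e, hp]
  simp

theorem zpow_mem_weightSpace {h : R} {p : Rˣ} {a : ℤ} (hp : (p : R) ∈ weightSpace K h a)
    (m : ℤ) : ((p ^ m : Rˣ) : R) ∈ weightSpace K h (m * a) := by
  induction m using Int.induction_on with
  | zero => simp [mem_weightSpace_zero]
  | succ k ih =>
    rw [zpow_add_one, Units.val_mul, add_mul, one_mul]
    exact mul_mem_weightSpace ih hp
  | pred k ih =>
    rw [zpow_sub_one, Units.val_mul, sub_mul, one_mul, sub_eq_add_neg]
    exact mul_mem_weightSpace ih (inv_mem_weightSpace hp)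

/-- The span of the weight vectors is a subalgebra. -/
def weightSubalgebra (K : Type*) [Field K] [Algebra K R] (h : R) : Subalgebra K R where
  __ := ⨆ m : ℤ, weightSpace K h m
  algebraMap_mem' c := by
    refine Submodule.mem_iSup_of_mem (p := weightSpace K h) 0 (mem_weightSpace_zero.2 ?_)
    exact (Algebra.commutes c h).symm
  mul_mem' := by
    intro x y hx hy
    change x ∈ ⨆ m : ℤ, weightSpace K h m at hx
    change y ∈ ⨆ m : ℤ, weightSpace K h m at hy
    change x * y ∈ ⨆ m : ℤ, weightSpace K h m
    induction hx using Submodule.iSup_induction' with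
    | zero => rw [zero_mul]; exact Submodule.zero_mem _
    | add x x' _ _ h1 h2 => rw [add_mul]; exact Submodule.add_mem _ h1 h2
    | mem a x hx =>
      induction hy using Submodule.iSup_induction' with
      | zero => rw [mul_zero]; exact Submodule.zero_mem _
      | add y y' _ _ h1 h2 => rw [mul_add]; exact Submodule.add_mem _ h1 h2
      | mem b y hy => exact Submodule.mem_iSup_of_mem (a + b) (mul_mem_weightSpace hx hy)

theorem mem_weightSubalgebra {h x : R} :
    x ∈ weightSubalgebra K h ↔ x ∈ ⨆ m : ℤ, weightSpace K h m := Iff.rfl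

theorem mem_weightSubalgebra_of_mem {h x : R} {m : ℤ} (hx : x ∈ weightSpace K h m) :
    x ∈ weightSubalgebra K h :=
  mem_weightSubalgebra.2 (Submodule.mem_iSup_of_mem m hx)

/-- If `R` is spanned by the weight vectors of `ad h`, two additive maps which agree on these
are equal. -/
theorem apply_eq_of_weightSpace {M : Type*} [AddCommGroup M] {h : R}
    (htop : weightSubalgebra K h = ⊤) (f g : R →+ M)
    (hfg : ∀ m : ℤ, ∀ x ∈ weightSpace K h m, f x = g x) (x : R) : f x = g x := by
  have hx : x ∈ ⨆ m : ℤ, weightSpace K h m :=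
    mem_weightSubalgebra.1 (htop ▸ Algebra.mem_top)
  induction hx using Submodule.iSup_induction' with
  | zero => simp
  | add x y _ _ h1 h2 => rw [map_add, map_add, h1, h2]
  | mem m x hx => exact hfg m x hx

/-- If `R` is spanned by the weight vectors of `ad h`, there is an additive map multiplying the
vectors of weight `m` by `p ^ m` on the right. For `p` of weight `-1` this is a projection onto
the centralizer of `h`. -/
theorem exists_twistedProj [CharZero K] {h : R} (p : Rˣ) (htop : weightSubalgebra K h = ⊤) :
    ∃ P : R →+ R, ∀ m : ℤ, ∀ x ∈ weightSpace K h m, P x = x * ((p ^ m : Rˣ) : R) := by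
  classical
  have hint : DirectSum.IsInternal (weightSpace K h) := by
    rw [DirectSum.isInternal_submodule_iff_iSupIndep_and_iSup_eq_top]
    refine ⟨(Module.End.eigenspaces_iSupIndep
      (LinearMap.mulLeft K h - LinearMap.mulRight K h)).comp Int.cast_injective, ?_⟩
    rw [eq_top_iff]
    intro x _
    exact mem_weightSubalgebra.1 (htop ▸ Algebra.mem_top)
  let e := LinearEquiv.ofBijective (DirectSum.coeLinearMap (weightSpace K h)) hint
  let Q := DirectSum.toModule K ℤ R
    fun m : ℤ => (LinearMap.mulRight K ((p ^ m : Rˣ) : R)).comp (weightSpace K h m).subtype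
  refine ⟨(Q ∘ₗ e.symm.toLinearMap).toAddMonoidHom, fun m x hx => ?_⟩
  have hex : e.symm x = DirectSum.lof K ℤ (fun m => weightSpace K h m) m ⟨x, hx⟩ := by
    rw [LinearEquiv.symm_apply_eq]
    exact (DirectSum.coeLinearMap_lof (weightSpace K h) m ⟨x, hx⟩).symm
  change Q (e.symm x) = _
  rw [hex, DirectSum.toModule_lof]
  rfl

section TwistedProj

variable {h : R} {p : Rˣ} (hp : (p : R) ∈ weightSpace K h (-1))
  (htop : weightSubalgebra K h = ⊤) {P : R →+ R}
  (hP : ∀ m : ℤ, ∀ x ∈ weightSpace K h m, P x = x * ((p ^ m : Rˣ) : R))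
include hP

theorem twistedProj_of_commute {x : R} (hx : Commute h x) : P x = x := by
  rw [hP 0 x (mem_weightSpace_zero.2 hx)]; simp

include htop

theorem twistedProj_mul_of_commute {z : R} (hhz : Commute h z) (hpz : Commute (p : R) z) (x : R) :
    P (x * z) = P x * z :=
  apply_eq_of_weightSpace htop (P.comp (AddMonoidHom.mulRight z))
    ((AddMonoidHom.mulRight z).comp P) (fun m x hx => by
      have h1 := mul_mem_weightSpace hx (mem_weightSpace_zero.2 hhz)
      rw [add_zero] at h1
      have h2 : Commute ((p ^ m : Rˣ) : R) z := hpz.units_zpow_left m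
      simp only [AddMonoidHom.comp_apply, AddMonoidHom.coe_mulRight]
      rw [hP m _ h1, hP m x hx, mul_assoc, mul_assoc, h2.eq]) x

theorem twistedProj_mul_of_commute_left {z : R} (hhz : Commute h z) (x : R) :
    P (z * x) = z * P x :=
  apply_eq_of_weightSpace htop (P.comp (AddMonoidHom.mulLeft z))
    ((AddMonoidHom.mulLeft z).comp P) (fun m x hx => by
      have h1 := mul_mem_weightSpace (mem_weightSpace_zero.2 hhz) hx
      rw [zero_add] at h1
      simp only [AddMonoidHom.comp_apply, AddMonoidHom.coe_mulLeft]
      rw [hP m _ h1, hP m x hx, mul_assoc]) x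

theorem commute_twistedProj_of_commute {z : R} (hhz : Commute h z) (hpz : Commute (p : R) z)
    {x : R} (hx : Commute z x) : Commute z (P x) := by
  rw [Commute, SemiconjBy, ← twistedProj_mul_of_commute_left htop hP hhz,
    ← twistedProj_mul_of_commute htop hP hhz hpz, hx.eq]

/-- A map which does not see right multiplication by `p` does not see the twisted projection. -/
theorem apply_twistedProj {M : Type*} [AddCommGroup M] (f : R →+ M)
    (hf : ∀ x, f (x * p) = f x) (x : R) : f (P x) = f x := by
  have hf' : ∀ (m : ℤ) (x : R), f (x * ((p ^ m : Rˣ) : R)) = f x := by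
    intro m
    induction m using Int.induction_on with
    | zero => simp
    | succ k ih => intro x; rw [zpow_add_one, Units.val_mul, ← mul_assoc, hf, ih]
    | pred k ih =>
      intro x
      rw [zpow_sub_one, Units.val_mul, ← mul_assoc, ← hf, mul_assoc, Units.inv_mul, mul_one, ih]
  exact apply_eq_of_weightSpace htop (f.comp P) f
    (fun m x hx => by rw [AddMonoidHom.comp_apply, hP m x hx, hf']) x

include hp

theorem twistedProj_mul_unit (x : R) : P (x * p) = P x :=
  apply_eq_of_weightSpace htop (P.comp (AddMonoidHom.mulRight (p : R))) P (fun m x hx => by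
      simp only [AddMonoidHom.comp_apply, AddMonoidHom.coe_mulRight]
      rw [hP _ _ (mul_mem_weightSpace hx hp), hP m x hx, mul_assoc, ← Units.val_mul,
        ← zpow_one_add]
      congr 3
      ring) x

theorem commute_twistedProj (x : R) : Commute h (P x) :=
  apply_eq_of_weightSpace htop ((AddMonoidHom.mulLeft h).comp P)
    ((AddMonoidHom.mulRight h).comp P) (fun m x hx => by
      have h1 := mul_mem_weightSpace hx (zpow_mem_weightSpace hp m)
      rw [mul_neg_one, add_neg_cancel, mem_weightSpace_zero] at h1
      simp only [AddMonoidHom.comp_apply, AddMonoidHom.coe_mulLeft, AddMonoidHom.coe_mulRight]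
      rw [hP m x hx, h1.eq]) x

theorem twistedProj_unit_mul (x : R) : P (p * x) = p * P x * ((p⁻¹ : Rˣ) : R) :=
  apply_eq_of_weightSpace htop (P.comp (AddMonoidHom.mulLeft (p : R)))
    ((AddMonoidHom.mulRight ((p⁻¹ : Rˣ) : R)).comp ((AddMonoidHom.mulLeft (p : R)).comp P))
    (fun m x hx => by
      simp only [AddMonoidHom.comp_apply, AddMonoidHom.coe_mulRight, AddMonoidHom.coe_mulLeft]
      rw [hP _ _ (mul_mem_weightSpace hp hx), hP m x hx, ← mul_assoc, mul_assoc (_ * _),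
        ← Units.val_mul, ← zpow_sub_one]
      congr 3
      ring) x

theorem commute_unit_twistedProj {x : R} (hx : Commute (p : R) x) : Commute (p : R) (P x) := by
  have h1 := twistedProj_unit_mul hp htop hP x
  rw [hx.eq, twistedProj_mul_unit hp htop hP] at h1
  have h2 : P x * p = p * P x := by
    nth_rw 1 [h1]
    rw [mul_assoc, Units.inv_mul, mul_one]
  exact h2.symm

end TwistedProj

/-- The composite of the twisted projections for all indices: a projection onto the common
centralizer of the `h i` along the additive subgroup generated by the `x * p i - x`. -/
theorem exists_twistedProj_family [CharZero K] (M : Type*) [AddCommGroup M] {ι : Type*}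
    [Finite ι] {h : ι → R} {p : ι → Rˣ}
    (htop : ∀ i, weightSubalgebra K (h i) = ⊤) (hp : ∀ i, (p i : R) ∈ weightSpace K (h i) (-1))
    (hhp : ∀ i j, i ≠ j → Commute (h i) (p j : R)) (hpp : ∀ i j, Commute (p i : R) (p j))
    (hhh : ∀ i j, Commute (h i) (h j)) :
    ∃ P : R →+ R, (∀ i x, P (x * p i) = P x) ∧ (∀ x, (∀ i, Commute (h i) x) → P x = x) ∧
      (∀ i x, Commute (h i) (P x)) ∧
      (∀ x, (∀ i, Commute (p i : R) x) → ∀ i, Commute (p i : R) (P x)) ∧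
      ∀ f : R →+ M, (∀ i x, f (x * p i) = f x) →
        ∀ x, f (P x) = f x := by
  classical
  cases nonempty_fintype ι
  choose P hP using fun i => exists_twistedProj (p i) (htop i)
  suffices H : ∀ J : Finset ι, ∃ T : R →+ R, (∀ i ∈ J, ∀ x, T (x * p i) = T x) ∧
      (∀ i ∉ J, ∀ x, T (x * p i) = T x * p i) ∧ (∀ x, (∀ i, Commute (h i) x) → T x = x) ∧
      (∀ i ∈ J, ∀ x, Commute (h i) (T x)) ∧
      (∀ x, (∀ i, Commute (p i : R) x) → ∀ i, Commute (p i : R) (T x)) ∧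
      ∀ f : R →+ M, (∀ i x, f (x * p i) = f x) →
        ∀ x, f (T x) = f x by
    obtain ⟨T, h1, -, h3, h4, h5, h6⟩ := H Finset.univ
    exact ⟨T, fun i => h1 i (Finset.mem_univ i), h3, fun i => h4 i (Finset.mem_univ i), h5, h6⟩
  intro J
  induction J using Finset.induction_on with
  | empty => exact ⟨AddMonoidHom.id R, by simp, by simp, by simp, by simp, by simp, by simp⟩
  | insert i J hi ih =>
    obtain ⟨T, h1, h2, h3, h4, h5, h6⟩ := ih
    refine ⟨(P i).comp T, ?_, ?_, ?_, ?_, ?_, ?_⟩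
    · intro j hj x
      rw [AddMonoidHom.comp_apply, AddMonoidHom.comp_apply]
      rcases Finset.mem_insert.1 hj with rfl | hj
      · rw [h2 j hi, twistedProj_mul_unit (hp j) (htop j) (hP j)]
      · rw [h1 j hj]
    · intro j hj x
      rw [Finset.mem_insert, not_or] at hj
      rw [AddMonoidHom.comp_apply, AddMonoidHom.comp_apply, h2 j hj.2,
        twistedProj_mul_of_commute (htop i) (hP i) (hhp i j (Ne.symm hj.1)) (hpp i j)]
    · intro x hx
      rw [AddMonoidHom.comp_apply, h3 x hx, twistedProj_of_commute (hP i) (hx i)]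
    · intro j hj x
      rw [AddMonoidHom.comp_apply]
      by_cases hij : j = i
      · rw [hij]
        exact commute_twistedProj (hp i) (htop i) (hP i) _
      · exact commute_twistedProj_of_commute (htop i) (hP i) (hhh i j) (hhp j i hij).symm
          (h4 j (Finset.mem_of_mem_insert_of_ne hj hij) x)
    · intro x hx j
      rw [AddMonoidHom.comp_apply]
      by_cases hij : j = i
      · rw [hij]
        exact commute_unit_twistedProj (hp i) (htop i) (hP i) (h5 x hx i)
      · exact commute_twistedProj_of_commute (htop i) (hP i) (hhp i j (Ne.symm hij)) (hpp i j)
          (h5 x hx j)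
    · intro f hf x
      rw [AddMonoidHom.comp_apply, apply_twistedProj (htop i) (hP i) f (hf i), h6 f hf]

end Weight

/-! ### Whittaker vectors and the centralizer of the `p i` -/

section Slice

variable {K R M : Type*} [Field K] [CharZero K] [Ring R] [Algebra K R] [AddCommGroup M]
  [Module R M]

theorem adMap_eq_zero_iff {p x : R} : adMap p x = 0 ↔ Commute p x := by
  rw [adMap_apply, sub_eq_zero]; rfl

theorem adMap_mul_of_commute {p z : R} (hz : Commute p z) (x : R) :
    adMap p (z * x) = z * adMap p x := by
  rw [adMap_mul, adMap_eq_zero_iff.2 hz, zero_mul, zero_add]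

theorem iterate_adMap_mul_of_commute {p z : R} (hz : Commute p z) (k : ℕ) (x : R) :
    (adMap p)^[k] (z * x) = z * (adMap p)^[k] x := by
  induction k generalizing x with
  | zero => rfl
  | succ k ih => rw [Function.iterate_succ_apply, adMap_mul_of_commute hz, ih,
      Function.iterate_succ_apply]

theorem iterate_adMap_slice_mul {p y : R} (hy : adMap p y = 1) (k : ℕ) (x : R) :
    (adMap p)^[k + 1] (y * x) = y * (adMap p)^[k + 1] x + (k + 1 : ℕ) • (adMap p)^[k] x := by
  induction k generalizing x with
  | zero => simp [adMap_mul, hy, add_comm]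
  | succ k ih =>
    rw [Function.iterate_succ_apply, adMap_mul, hy, one_mul, iterate_map_add, ih,
      ← Function.iterate_succ_apply (adMap p) (k + 1), ← Function.iterate_succ_apply (adMap p) k,
      add_left_comm, ← succ_nsmul' ]

/-- Let `y` be a slice for the locally nilpotent derivation `ad p`. If `x v` is fixed by `p`, then
`x` may be replaced by an element commuting with `p`, without changing `x v`: as long as
`(ad p)^(k+1) x = 0` with `k > 0`, subtract `k⁻¹ y [p, x]`, which kills `v`. The correction
commutes with everything that commutes with `x`, `y` and `p`. -/
theorem exists_commute_smul_eq (K : Type*) [Field K] [CharZero K] [Algebra K R]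
    {p y : R} (hy : adMap p y = 1) {v : M} (hv : p • v = v)
    (k : ℕ) : ∀ x : R, (adMap p)^[k + 1] x = 0 → p • x • v = x • v →
    ∃ x' : R, Commute p x' ∧ x' • v = x • v ∧
      ∀ z, Commute z x → Commute z y → Commute z p → Commute z x' := by
  induction k with
  | zero =>
    intro x hx _
    exact ⟨x, adMap_eq_zero_iff.1 hx, rfl, fun z hz _ _ => hz⟩
  | succ k ih =>
    intro x hx hxv
    set c : K := ((k + 1 : ℕ) : K)⁻¹ with hc
    have hc0 : ((k + 1 : ℕ) : K) ≠ 0 := Nat.cast_ne_zero.2 (Nat.succ_ne_zero k)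
    have hker : (c • (y * adMap p x)) • v = 0 := by
      rw [← smul_mul_assoc, mul_smul, adMap_apply, sub_smul, mul_smul, mul_smul, hv, hxv, sub_self,
        smul_zero]
    have h1 : (x - c • (y * adMap p x)) • v = x • v := by rw [sub_smul, hker, sub_zero]
    have hcomm : Commute p (algebraMap K R c) := (Algebra.commutes c p).symm
    obtain ⟨x', h2, h3, h4⟩ := ih (x - c • (y * adMap p x)) (by
      rw [iterate_map_sub, Algebra.smul_def, iterate_adMap_mul_of_commute hcomm,
        iterate_adMap_slice_mul hy, ← Function.iterate_succ_apply, hx, mul_zero, zero_add,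
        ← Function.iterate_succ_apply, ← Algebra.smul_def, ← Nat.cast_smul_eq_nsmul K, smul_smul,
        hc, inv_mul_cancel₀ hc0, one_smul, sub_self]) (by rw [h1, hxv])
    refine ⟨x', h2, h3.trans h1, fun z hzx hzy hzp => h4 z ?_ hzy hzp⟩
    refine hzx.sub_right ?_
    exact (hzy.mul_right ((hzp.mul_right hzx).sub_right (hzx.mul_right hzp))).smul_right c

/-- If each `ad (p i)` is locally nilpotent and the `y i` are slices for them, then every vector of
`R v` fixed by the `p i` is of the form `x v` with `x` commuting with the `p i`. -/
theorem exists_forall_commute_smul_eq (K : Type*) [Field K] [CharZero K] [Algebra K R]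
    {ι : Type*} [Finite ι] {p y : ι → R} (hpp : ∀ i j, Commute (p i) (p j))
    (hy : ∀ i, adMap (p i) (y i) = 1) (hpy : ∀ i j, i ≠ j → Commute (p i) (y j))
    (hnil : ∀ i x, ∃ k, (adMap (p i))^[k] x = 0) {v : M} (hv : ∀ i, p i • v = v) (x : R)
    (hx : ∀ i, p i • x • v = x • v) :
    ∃ x' : R, (∀ i, Commute (p i) x') ∧ x' • v = x • v := by
  classical
  cases nonempty_fintype ι
  suffices H : ∀ J : Finset ι, ∃ x' : R, (∀ i ∈ J, Commute (p i) x') ∧ x' • v = x • v by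
    obtain ⟨x', h1, h2⟩ := H Finset.univ
    exact ⟨x', fun i => h1 i (Finset.mem_univ i), h2⟩
  intro J
  induction J using Finset.induction_on with
  | empty => exact ⟨x, by simp, rfl⟩
  | insert i J hi ih =>
    obtain ⟨x', h1, h2⟩ := ih
    obtain ⟨k, hk⟩ := hnil i x'
    obtain ⟨x'', h3, h4, h5⟩ := exists_commute_smul_eq K (hy i) (hv i) k x'
      (by rw [Function.iterate_succ_apply', hk, map_zero]) (by rw [h2, hx])
    refine ⟨x'', fun j hj => ?_, h4.trans h2⟩
    rcases Finset.mem_insert.1 hj with rfl | hj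
    · exact h3
    · exact h5 _ (h1 j hj) (hpy j i fun e => hi (e ▸ hj)) (hpp j i)

end Slice

/-! ### Weights of the Euler fields on the Witt algebra and on its enveloping algebra -/

/-- An enveloping algebra is generated by its Lie algebra. -/
theorem eq_top_of_ι_mem {L : Type*} [LieRing L] [LieAlgebra ℂ L]
    (S : Subalgebra ℂ (UniversalEnvelopingAlgebra ℂ L))
    (hS : ∀ D : L, UniversalEnvelopingAlgebra.ι ℂ D ∈ S) : S = ⊤ := by
  let f : L →ₗ⁅ℂ⁆ S :=
    { toFun := fun D => ⟨UniversalEnvelopingAlgebra.ι ℂ D, hS D⟩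
      map_add' := fun x y => Subtype.ext (map_add _ x y)
      map_smul' := fun c x => Subtype.ext (map_smul _ c x)
      map_lie' := fun {x y} => Subtype.ext (LieHom.map_lie _ x y) }
  have hf : S.val.comp (UniversalEnvelopingAlgebra.lift ℂ f) = AlgHom.id ℂ _ := by
    apply UniversalEnvelopingAlgebra.hom_ext
    ext D
    change ((UniversalEnvelopingAlgebra.lift ℂ f (UniversalEnvelopingAlgebra.ι ℂ D) : S) : _)
      = UniversalEnvelopingAlgebra.ι ℂ D
    rw [UniversalEnvelopingAlgebra.lift_ι_apply]
    rfl
  rw [eq_top_iff]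
  intro r _
  have := (UniversalEnvelopingAlgebra.lift ℂ f r).2
  rwa [show ((UniversalEnvelopingAlgebra.lift ℂ f r : S) : _) = r from DFunLike.congr_fun hf r]
    at this

variable {n : ℕ}

/-- The vector field `f ∂_j`. -/
def fieldW (j : Fin n) : A n →ₗ[ℂ] WittAlg n where
  toFun f := toDer.symm (f • MvPolynomial.pderiv j)
  map_add' f g := by rw [add_smul, map_add]
  map_smul' c f := by rw [smul_assoc, map_smul, RingHom.id_apply]

theorem toDer_fieldW (j : Fin n) (f g : A n) :
    toDer (fieldW j f) g = f * MvPolynomial.pderiv j g := rfl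

theorem partialW_eq_fieldW (j : Fin n) : partialW j = fieldW j (MvPolynomial.monomial 0 1) := by
  change _ = toDer.symm ((1 : A n) • MvPolynomial.pderiv j)
  rw [one_smul]; rfl

theorem eulerW_eq_fieldW (j : Fin n) :
    eulerW j = fieldW j (MvPolynomial.monomial (Finsupp.single j 1) 1) := rfl

theorem eq_sum_fieldW (D : WittAlg n) : D = ∑ j, fieldW j (toDer D (MvPolynomial.X j)) := by
  refine WittAlg.ext fun k => ?_
  rw [map_sum]
  refine Eq.symm ((congrFun (map_sum (Derivation.coeFnAddMonoidHom (R := ℂ) (A := A n) (M := A n))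
    (fun j => toDer (fieldW j (toDer D (MvPolynomial.X j)))) Finset.univ)
      (MvPolynomial.X k)).trans ?_)
  rw [Finset.sum_apply, Finset.sum_eq_single k]
  · refine (toDer_fieldW _ _ _).trans ?_
    rw [MvPolynomial.pderiv_X_self, mul_one]
  · intro j _ hj
    refine (toDer_fieldW _ _ _).trans ?_
    rw [MvPolynomial.pderiv_X_of_ne hj.symm, mul_zero]
  · simp

/-- `t^s ∂_j` has weight `s_i - δ_ij` for `h_i`. -/
theorem eulerW_lie_fieldW_monomial (i j : Fin n) (s : Fin n →₀ ℕ) (a : ℂ) :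
    ⁅eulerW i, fieldW j (MvPolynomial.monomial s a)⁆ =
      ((((s i : ℤ) - if i = j then 1 else 0 : ℤ)) : ℂ) •
        fieldW j (MvPolynomial.monomial s a) := by
  refine WittAlg.ext fun k => ?_
  have h1 : ∀ g : A n, toDer (eulerW i) g = MvPolynomial.X i * MvPolynomial.pderiv i g :=
    fun _ => rfl
  have h2 : MvPolynomial.X i * MvPolynomial.pderiv i (MvPolynomial.monomial s a) =
      s i • MvPolynomial.monomial s a := MvPolynomial.X_mul_pderiv_monomial
  rw [toDer_lie, map_smul, Derivation.coe_smul, Pi.smul_apply, toDer_fieldW, toDer_fieldW, h1, h1]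
  by_cases hjk : k = j
  · subst hjk
    rw [MvPolynomial.pderiv_X_self, mul_one, h2]
    by_cases hik : i = k
    · subst hik
      rw [MvPolynomial.pderiv_X_self, mul_one, MvPolynomial.pderiv_X_self, mul_one, if_pos rfl]
      push_cast
      rw [sub_smul, one_smul, Nat.cast_smul_eq_nsmul]
    · rw [MvPolynomial.pderiv_X_of_ne (Ne.symm hik), mul_zero, map_zero, mul_zero, if_neg hik]
      push_cast
      rw [sub_zero, sub_zero, Nat.cast_smul_eq_nsmul]
  · rw [MvPolynomial.pderiv_X_of_ne hjk, mul_zero, map_zero, mul_zero, smul_zero, zero_sub,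
      neg_eq_zero]
    by_cases hik : k = i
    · subst hik
      rw [MvPolynomial.pderiv_X_self, mul_one, MvPolynomial.pderiv_X_of_ne hjk, mul_zero]
    · rw [MvPolynomial.pderiv_X_of_ne hik, mul_zero, map_zero, mul_zero]

theorem ι_fieldW_monomial_mem (i j : Fin n) (s : Fin n →₀ ℕ) (a : ℂ) :
    (UniversalEnvelopingAlgebra.ι ℂ (fieldW j (MvPolynomial.monomial s a)) : U n) ∈
      weightSpace ℂ (eulerU i) ((s i : ℤ) - if i = j then 1 else 0) := by
  rw [mem_weightSpace, ← map_smul, ← eulerW_lie_fieldW_monomial, LieHom.map_lie]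
  rfl

theorem partialU_mem_weightSpace (i j : Fin n) :
    (partialU j : U n) ∈ weightSpace ℂ (eulerU i) (-if i = j then 1 else 0) := by
  have := ι_fieldW_monomial_mem i j 0 1
  rwa [← partialW_eq_fieldW, Finsupp.coe_zero, Pi.zero_apply, Nat.cast_zero, zero_sub] at this

theorem commute_eulerU (i j : Fin n) : Commute (eulerU i : U n) (eulerU j) := by
  have := ι_fieldW_monomial_mem i j (Finsupp.single j 1) 1
  rw [← eulerW_eq_fieldW] at this
  rw [← mem_weightSpace_zero (K := ℂ)]
  change UniversalEnvelopingAlgebra.ι ℂ (eulerW j) ∈ _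
  convert this using 2
  by_cases h : i = j
  · subst h; simp
  · simp [h]

theorem commute_partialU (i j : Fin n) : Commute (partialU i : U n) (partialU j) := by
  have h := LieHom.map_lie (UniversalEnvelopingAlgebra.ι ℂ) (partialW i : WittAlg n) (partialW j)
  rw [partialW_lie, map_zero] at h
  exact (sub_eq_zero.1 h.symm : _)

theorem weightSubalgebra_eulerU (i : Fin n) : weightSubalgebra ℂ (eulerU i : U n) = ⊤ := by
  refine eq_top_of_ι_mem _ fun D => ?_
  rw [eq_sum_fieldW D, map_sum]
  refine sum_mem fun j _ => ?_
  induction toDer D (MvPolynomial.X j) using MvPolynomial.induction_on' with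
  | monomial s a => exact mem_weightSubalgebra_of_mem (ι_fieldW_monomial_mem i j s a)
  | add f g hf hg => rw [map_add, map_add]; exact add_mem hf hg

/-! ### The localization -/

/-- The localization map as a homomorphism of `ℂ`-algebras. -/
def toULocAlg (n : ℕ) : U n →ₐ[ℂ] ULoc n where
  __ := toULoc n
  commutes' _ := rfl

theorem map_mem_weightSpace {R S : Type*} [Ring R] [Ring S] [Algebra ℂ R] [Algebra ℂ S]
    (f : R →ₐ[ℂ] S) {h x : R} {m : ℤ} (hx : x ∈ weightSpace ℂ h m) :
    f x ∈ weightSpace ℂ (f h) m := by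
  rw [mem_weightSpace] at *
  rw [← map_mul, ← map_mul, ← map_sub, hx, map_smul]

theorem isUnit_toULoc {s : U n} (hs : s ∈ partialMonoid n) : IsUnit (toULoc n s) :=
  OreLocalization.numerator_isUnit (⟨s, hs⟩ : partialMonoid n)

theorem partialU_mem (i : Fin n) : (partialU i : U n) ∈ partialMonoid n :=
  Submonoid.subset_closure (Set.mem_range_self i)

theorem exists_toULoc_mul_eq (x : ULoc n) :
    ∃ s ∈ partialMonoid n, ∃ r : U n, toULoc n s * x = toULoc n r := by
  induction x using OreLocalization.ind with
  | _ r s => exact ⟨s, s.2, r, OreLocalization.mul_cancel⟩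

/-- `∂_i` as a unit of `U_∂`. -/
def partialUnit (i : Fin n) : (ULoc n)ˣ := (isUnit_toULoc (partialU_mem i)).unit

theorem val_partialUnit (i : Fin n) :
    ((partialUnit i : (ULoc n)ˣ) : ULoc n) = toULoc n (partialU i) := rfl

theorem weightSubalgebra_toULoc_eulerU (i : Fin n) :
    weightSubalgebra ℂ (toULoc n (eulerU i)) = ⊤ := by
  have hU : ∀ r : U n, toULoc n r ∈ weightSubalgebra ℂ (toULoc n (eulerU i)) := by
    intro r
    have hr : r ∈ ⨆ m : ℤ, weightSpace ℂ (eulerU i : U n) m :=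
      mem_weightSubalgebra.1 (weightSubalgebra_eulerU i ▸ Algebra.mem_top)
    induction hr using Submodule.iSup_induction' with
    | zero => rw [map_zero]; exact zero_mem _
    | add x y _ _ h1 h2 => rw [map_add]; exact add_mem h1 h2
    | mem m x hx => exact mem_weightSubalgebra_of_mem (map_mem_weightSpace (toULocAlg n) hx)
  have hs : ∀ s ∈ partialMonoid n, ∃ m : ℤ, s ∈ weightSpace ℂ (eulerU i : U n) m := by
    intro s hs
    induction hs using Submonoid.closure_induction with
    | mem x hx => obtain ⟨j, rfl⟩ := hx; exact ⟨_, partialU_mem_weightSpace i j⟩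
    | one => exact ⟨0, mem_weightSpace_zero.2 (Commute.one_right _)⟩
    | mul x y _ _ hx hy =>
      obtain ⟨a, ha⟩ := hx
      obtain ⟨b, hb⟩ := hy
      exact ⟨a + b, mul_mem_weightSpace ha hb⟩
  rw [eq_top_iff]
  intro x _
  obtain ⟨s, hsm, r, h⟩ := exists_toULoc_mul_eq x
  obtain ⟨m, hm⟩ := hs s hsm
  obtain ⟨u, hu⟩ := isUnit_toULoc hsm
  have hum : (u : ULoc n) ∈ weightSpace ℂ (toULoc n (eulerU i)) m := by
    rw [hu]; exact map_mem_weightSpace (toULocAlg n) hm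
  have hx : x = ((u⁻¹ : (ULoc n)ˣ) : ULoc n) * toULoc n r := by
    rw [← h, ← hu, Units.inv_mul_cancel_left]
  rw [hx]
  exact mul_mem (mem_weightSubalgebra_of_mem (inv_mem_weightSpace hum)) (hU r)

theorem commute_partialUnit (i j : Fin n) :
    Commute ((partialUnit i : (ULoc n)ˣ) : ULoc n) (partialUnit j : (ULoc n)ˣ) :=
  (commute_partialU i j).map (toULoc n)

theorem partialUnit_mem_weightSpace (i j : Fin n) :
    ((partialUnit j : (ULoc n)ˣ) : ULoc n) ∈
      weightSpace ℂ (toULoc n (eulerU i)) (-if i = j then 1 else 0) :=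
  map_mem_weightSpace (toULocAlg n) (partialU_mem_weightSpace i j)

theorem commute_eulerU_partialUnit {i j : Fin n} (h : i ≠ j) :
    Commute (toULoc n (eulerU i)) (partialUnit j : (ULoc n)ˣ) := by
  have := partialUnit_mem_weightSpace i j
  rwa [if_neg h, neg_zero, mem_weightSpace_zero] at this

theorem commute_partialUnit_of_mem {s : U n} (hs : s ∈ partialMonoid n) {x : ULoc n}
    (hx : ∀ i, Commute ((partialUnit i : (ULoc n)ˣ) : ULoc n) x) : Commute (toULoc n s) x := by
  induction hs using Submonoid.closure_induction with
  | mem y hy => obtain ⟨j, rfl⟩ := hy; exact hx j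
  | one => rw [map_one]; exact Commute.one_left x
  | mul y z _ _ hy hz => rw [map_mul]; exact hy.mul_left hz

/-- `ad ∂_i` is locally nilpotent on `U_∂`. -/
theorem ad_partialUnit_nilpotent (i : Fin n) (x : ULoc n) :
    ∃ k, (adMap ((partialUnit i : (ULoc n)ˣ) : ULoc n))^[k] x = 0 := by
  obtain ⟨s, hs, r, h⟩ := exists_toULoc_mul_eq x
  obtain ⟨k, hk⟩ := ad_partialU_nilpotent i r
  refine ⟨k, (isUnit_toULoc hs).mul_right_eq_zero.1 ?_⟩
  have hc := (commute_partialUnit_of_mem hs (commute_partialUnit · i)).symm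
  have hmap : Function.Semiconj (toULoc n) (adMap (partialU i))
      (adMap ((partialUnit i : (ULoc n)ˣ) : ULoc n)) := fun y => by
    rw [adMap_apply, adMap_apply, map_sub, map_mul, map_mul, val_partialUnit]
  rw [← iterate_adMap_mul_of_commute hc, h, ← (hmap.iterate_right k) r, hk, map_zero]

/-- `h_i ∂_i⁻¹`, a slice for the derivation `ad ∂_i`: it plays the part of `t_i`. -/
def slice (i : Fin n) : ULoc n := toULoc n (eulerU i) * ((partialUnit i)⁻¹ : (ULoc n)ˣ)

theorem adMap_slice (i : Fin n) :
    adMap ((partialUnit i : (ULoc n)ˣ) : ULoc n) (slice i) = 1 := by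
  have h := partialUnit_mem_weightSpace i i
  rw [if_pos rfl, mem_weightSpace, Int.cast_neg, Int.cast_one, neg_smul, one_smul,
    sub_eq_iff_eq_add] at h
  rw [adMap_apply, slice, mul_assoc, Units.inv_mul, mul_one, ← mul_assoc, ← sub_eq_zero]
  have h' : ((partialUnit i : (ULoc n)ˣ) : ULoc n) * toULoc n (eulerU i) =
      toULoc n (eulerU i) * (partialUnit i : (ULoc n)ˣ) + (partialUnit i : (ULoc n)ˣ) := by
    rw [h]; abel
  rw [h', add_mul, mul_assoc, Units.mul_inv, mul_one]
  abel

theorem commute_slice {i j : Fin n} (h : i ≠ j) :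
    Commute ((partialUnit i : (ULoc n)ˣ) : ULoc n) (slice j) :=
  (commute_eulerU_partialUnit h.symm).symm.mul_right (commute_partialUnit i j).units_inv_right

theorem mem_H_iff {x : ULoc n} : x ∈ H n ↔
    (∀ i, Commute ((partialUnit i : (ULoc n)ˣ) : ULoc n) x) ∧
      ∀ i, Commute (toULoc n (eulerU i)) x := by
  rw [H, Subalgebra.mem_centralizer_iff]
  constructor
  · intro h
    exact ⟨fun i => h _ (Or.inl ⟨i, rfl⟩), fun i => h _ (Or.inr ⟨i, rfl⟩)⟩
  · rintro ⟨h1, h2⟩ _ (⟨i, rfl⟩ | ⟨i, rfl⟩)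
    · exact h1 i
    · exact h2 i

/-- The twisted projection of `U_∂`: it restricts to the identity on `H_n`, maps the centralizer of
`Δ_n` to `H_n`, and factors through the quotient by the left ideal of the `∂_i - 1`. -/
theorem exists_proj_H (n : ℕ) (M : Type*) [AddCommGroup M] :
    ∃ P : ULoc n →+ ULoc n, (∀ i x, P (x * (partialUnit i : (ULoc n)ˣ)) = P x) ∧
      (∀ x ∈ H n, P x = x) ∧
      (∀ x, (∀ i, Commute ((partialUnit i : (ULoc n)ˣ) : ULoc n) x) → P x ∈ H n) ∧
      ∀ f : ULoc n →+ M, (∀ i x, f (x * (partialUnit i : (ULoc n)ˣ)) = f x) →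
        ∀ x, f (P x) = f x := by
  obtain ⟨P, h1, h2, h3, h4, h5⟩ := exists_twistedProj_family (K := ℂ) M
    (h := fun i : Fin n => toULoc n (eulerU i)) (p := partialUnit) weightSubalgebra_toULoc_eulerU
    (fun i => by simpa using partialUnit_mem_weightSpace i i)
    (fun _ _ => commute_eulerU_partialUnit) commute_partialUnit
    (fun i j => (commute_eulerU i j).map (toULoc n))
  exact ⟨P, h1, fun x hx => h2 x (mem_H_iff.1 hx).2,
    fun x hx => mem_H_iff.2 ⟨h4 x hx, fun i => h3 i x⟩, h5⟩

/-! ### The universal Whittaker module -/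

/-- The generator `1 ⊗ 1` of `Q_𝟏`. -/
def genQ (n : ℕ) : Q n := Submodule.Quotient.mk ((1 : U n) ⊗ₜ[ℂ] (show COne n from (1 : ℂ)))

theorem mk_tmul_eq (r : U n) (c : ℂ) :
    (Submodule.Quotient.mk (r ⊗ₜ[ℂ] (show COne n from c)) : Q n) = (c • r) • genQ n := by
  rw [genQ, ← Submodule.Quotient.mk_smul, TensorProduct.smul_tmul', smul_eq_mul, mul_one,
    TensorProduct.smul_tmul]
  congr 2
  exact (mul_one c).symm

theorem exists_smul_genQ (q : Q n) : ∃ r : U n, r • genQ n = q := by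
  obtain ⟨x, rfl⟩ := Submodule.Quotient.mk_surjective _ q
  induction x using TensorProduct.induction_on with
  | zero => exact ⟨0, by simp⟩
  | tmul r c => exact ⟨_, (mk_tmul_eq r c).symm⟩
  | add x y hx hy =>
    obtain ⟨a, ha⟩ := hx
    obtain ⟨b, hb⟩ := hy
    exact ⟨a + b, by rw [add_smul, ha, hb, Submodule.Quotient.mk_add]⟩

theorem inclU_ι (D : Delta n) : inclU n (UniversalEnvelopingAlgebra.ι ℂ D) =
    UniversalEnvelopingAlgebra.ι ℂ (D : WittAlg n) :=
  UniversalEnvelopingAlgebra.lift_ι_apply ℂ _ D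

theorem partialU_smul_genQ (i : Fin n) : (partialU i : U n) • genQ n = genQ n := by
  have h : ((1 : U n) * inclU n (UniversalEnvelopingAlgebra.ι ℂ
      ⟨partialW i, partialW_mem_Delta i⟩)) ⊗ₜ[ℂ] (show COne n from (1 : ℂ)) - (1 : U n) ⊗ₜ[ℂ]
      ((UniversalEnvelopingAlgebra.ι ℂ ⟨partialW i, partialW_mem_Delta i⟩ : UDelta n) •
        (show COne n from (1 : ℂ))) ∈ balanced (COne n) (inclU n) :=
    Submodule.subset_span ⟨_, _, _, rfl⟩
  have hc : ((UniversalEnvelopingAlgebra.ι ℂ ⟨partialW i, partialW_mem_Delta i⟩ : UDelta n) •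
        (show COne n from (1 : ℂ))) = (show COne n from (1 : ℂ)) := by
    change UniversalEnvelopingAlgebra.lift ℂ (charOne n) (UniversalEnvelopingAlgebra.ι ℂ _) *
      (1 : ℂ) = 1
    rw [UniversalEnvelopingAlgebra.lift_ι_apply, charOne_partialW, mul_one]
  rw [hc, inclU_ι, one_mul, ← Submodule.Quotient.mk_eq_zero, Submodule.Quotient.mk_sub,
    sub_eq_zero] at h
  rw [genQ, ← Submodule.Quotient.mk_smul, TensorProduct.smul_tmul', smul_eq_mul, mul_one]
  exact h

section Universal

variable {N : Type*} [AddCommGroup N] [Module ℂ N] [Module (U n) N] [IsScalarTower ℂ (U n) N]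

theorem inclU_smul {w : N} (hw : ∀ i, (partialU i : U n) • w = w) (a : UDelta n) :
    inclU n a • w = UniversalEnvelopingAlgebra.lift ℂ (charOne n) a • w := by
  let S : Subalgebra ℂ (UDelta n) :=
    { carrier := {a | inclU n a • w = UniversalEnvelopingAlgebra.lift ℂ (charOne n) a • w}
      mul_mem' := by
        intro a b ha hb
        change _ = _ at ha hb
        change _ = _
        rw [map_mul, map_mul, mul_smul, hb, ← algebraMap_smul (U n), ← mul_smul,
          ← Algebra.commutes, mul_smul, ha, algebraMap_smul, smul_smul, mul_comm]
      add_mem' := by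
        intro a b ha hb
        change _ = _ at ha hb
        change _ = _
        rw [map_add, map_add, add_smul, add_smul, ha, hb]
      algebraMap_mem' := by
        intro c
        change _ = _
        rw [AlgHom.commutes, AlgHom.commutes, algebraMap_smul]
        rfl }
  have hS : S = ⊤ := by
    refine eq_top_of_ι_mem S ?_
    rintro ⟨D, hD⟩
    change _ = _
    rw [inclU_ι, UniversalEnvelopingAlgebra.lift_ι_apply]
    change UniversalEnvelopingAlgebra.ι ℂ D • w = _
    have hD' : D ∈ Submodule.span ℂ (Set.range (partialW : Fin n → WittAlg n)) := hD
    induction hD' using Submodule.span_induction with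
    | mem x hx =>
      obtain ⟨i, rfl⟩ := hx
      exact (hw i).trans (by rw [charOne_partialW, one_smul])
    | zero =>
      rw [map_zero, zero_smul]
      exact (by rw [map_zero, zero_smul] : (0 : N) = charOne n 0 • w)
    | add x y hx hy h1 h2 =>
      rw [map_add, add_smul, h1 hx, h2 hy, ← add_smul, ← map_add]
      rfl
    | smul c x hx h1 =>
      rw [map_smul, smul_assoc, h1 hx, ← smul_assoc, ← map_smul]
      rfl
  exact (hS ▸ Algebra.mem_top : a ∈ S)

/-- The universal property of `Q_𝟏`: it is the free module on a Whittaker vector. -/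
theorem exists_hom_genQ {w : N} (hw : ∀ i, (partialU i : U n) • w = w) :
    ∃ φ : Q n →ₗ[U n] N, φ (genQ n) = w := by
  let F : U n ⊗[ℂ] COne n →ₗ[U n] N := TensorProduct.AlgebraTensorModule.lift
    (LinearMap.toSpanSingleton (U n) _
      ((LinearMap.toSpanSingleton ℂ N w : ℂ →ₗ[ℂ] N) : COne n →ₗ[ℂ] N))
  have hF : ∀ (r : U n) (c : ℂ), F (r ⊗ₜ[ℂ] (show COne n from c)) = r • c • w := fun _ _ => rfl
  have hle : balanced (COne n) (inclU n) ≤ LinearMap.ker F := by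
    refine Submodule.span_le.2 ?_
    rintro _ ⟨b, a, v, rfl⟩
    refine LinearMap.mem_ker.2 ?_
    rw [map_sub, sub_eq_zero]
    refine (hF (b * inclU n a) v).trans (Eq.trans ?_
      (hF b (UniversalEnvelopingAlgebra.lift ℂ (charOne n) a * (show ℂ from v))).symm)
    have hc : ∀ c : ℂ, (b * inclU n a) • c • w =
        b • (UniversalEnvelopingAlgebra.lift ℂ (charOne n) a * c) • w := by
      intro c
      rw [mul_comm, mul_smul c, ← inclU_smul hw, mul_smul, ← algebraMap_smul (U n) c w,
        ← mul_smul (inclU n a), ← Algebra.commutes, mul_smul, algebraMap_smul]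
    exact hc v
  refine ⟨(balanced (COne n) (inclU n)).liftQ F hle, ?_⟩
  refine (Submodule.liftQ_apply _ _ _).trans ((hF 1 1).trans ?_)
  rw [one_smul, one_smul]

end Universal

theorem hom_ext_genQ {N : Type*} [AddCommGroup N] [Module (U n) N] {φ ψ : Q n →ₗ[U n] N}
    (h : φ (genQ n) = ψ (genQ n)) : φ = ψ := by
  refine LinearMap.ext fun q => ?_
  obtain ⟨r, rfl⟩ := exists_smul_genQ q
  rw [map_smul, map_smul, h]

/-- The annihilator of the generator of `Q_𝟏` is the left ideal of the `∂_i - 1`. -/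
theorem mem_span_of_smul_genQ_eq_zero {r : U n} (hr : r • genQ n = 0) :
    r ∈ Submodule.span (U n) (Set.range fun i : Fin n => (partialU i - 1 : U n)) := by
  set I := Submodule.span (U n) (Set.range fun i : Fin n => (partialU i - 1 : U n))
  obtain ⟨φ, hφ⟩ := exists_hom_genQ (n := n) (w := (Submodule.Quotient.mk (1 : U n) : U n ⧸ I)) (by
    intro i
    rw [← Submodule.Quotient.mk_smul, ← sub_eq_zero, ← Submodule.Quotient.mk_sub,
      Submodule.Quotient.mk_eq_zero, smul_eq_mul, mul_one]
    exact Submodule.subset_span ⟨i, rfl⟩)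
  have h := congrArg φ hr
  rwa [map_zero, map_smul, hφ, ← Submodule.Quotient.mk_smul, Submodule.Quotient.mk_eq_zero,
    smul_eq_mul, mul_one] at h

/-- `∂_i - 1` is locally nilpotent on `Q_𝟏`. -/
theorem exists_iterate_partialU_sub_one (i : Fin n) (q : Q n) :
    ∃ k, (fun q : Q n => (partialU i : U n) • q - q)^[k] q = 0 := by
  obtain ⟨r, rfl⟩ := exists_smul_genQ q
  obtain ⟨k, hk⟩ := ad_partialU_nilpotent i r
  have h : Function.Semiconj (fun r : U n => r • genQ n) (adMap (partialU i))
      (fun q : Q n => (partialU i : U n) • q - q) := fun r => by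
    simp only [adMap_apply]
    rw [sub_smul, mul_smul, mul_smul, partialU_smul_genQ]
  exact ⟨k, ((h.iterate_right k) r).symm.trans (by rw [hk]; exact zero_smul _ _)⟩

theorem bijective_partialU_smul (i : Fin n) :
    Function.Bijective fun q : Q n => (partialU i : U n) • q := by
  constructor
  · intro a b hab
    have h0 : (partialU i : U n) • (a - b) = 0 := by rw [smul_sub]; exact sub_eq_zero.2 hab
    have hk : ∀ k q, (partialU i : U n) • q = 0 →
        (fun q : Q n => (partialU i : U n) • q - q)^[k] q = 0 → q = 0 := by
      intro k
      induction k with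
      | zero => exact fun q _ h => h
      | succ k ih =>
        intro q hq h
        rw [Function.iterate_succ_apply, hq, zero_sub] at h
        exact neg_eq_zero.1 (ih (-q) (by rw [smul_neg, hq, neg_zero]) h)
    obtain ⟨k, hk'⟩ := exists_iterate_partialU_sub_one i (a - b)
    exact sub_eq_zero.1 (hk k _ h0 hk')
  · intro q
    obtain ⟨k, hk⟩ := exists_iterate_partialU_sub_one i q
    induction k generalizing q with
    | zero => exact ⟨0, by rw [show q = 0 from hk]; exact smul_zero _⟩
    | succ k ih =>
      obtain ⟨q', hq'⟩ := ih _ hk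
      refine ⟨q - q', ?_⟩
      change (partialU i : U n) • q' = (partialU i : U n) • q - q at hq'
      change (partialU i : U n) • (q - q') = q
      rw [smul_sub, hq', sub_sub_cancel]

/-- The action of `U(W_n)` on `Q_𝟏`. -/
def actQ (n : ℕ) : U n →ₐ[ℂ] Module.End ℂ (Q n) := Algebra.lsmul ℂ ℂ (Q n)

theorem isUnit_actQ {s : U n} (hs : s ∈ partialMonoid n) : IsUnit (actQ n s) := by
  induction hs using Submonoid.closure_induction with
  | mem x hx =>
    obtain ⟨i, rfl⟩ := hx
    exact (Module.End.isUnit_iff _).2 (bijective_partialU_smul i)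
  | one => rw [map_one]; exact isUnit_one
  | mul x y _ _ hx hy => rw [map_mul]; exact hx.mul hy

/-- The extension of the action of `U(W_n)` on `Q_𝟏` to `U_∂`. -/
def actQLoc (n : ℕ) : ULoc n →+* Module.End ℂ (Q n) :=
  OreLocalization.universalHom (actQ n).toRingHom
    (IsUnit.liftRight ((actQ n).toRingHom.toMonoidHom.comp (partialMonoid n).subtype)
      fun s => isUnit_actQ s.2)
    fun _ => rfl

/-- `Q_𝟏` as a module over `U_∂`. -/
instance moduleULocQ (n : ℕ) : Module (ULoc n) (Q n) := Module.compHom (Q n) (actQLoc n)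

theorem toULoc_smul (r : U n) (q : Q n) : toULoc n r • q = r • q :=
  LinearMap.congr_fun
    (OreLocalization.universalHom_commutes (actQ n).toRingHom _ fun _ => rfl : _ = actQ n r) q

theorem partialUnit_smul_genQ (i : Fin n) :
    ((partialUnit i : (ULoc n)ˣ) : ULoc n) • genQ n = genQ n := by
  rw [val_partialUnit, toULoc_smul, partialU_smul_genQ]

/-- A `U(W_n)`-linear endomorphism of `Q_𝟏` is `U_∂`-linear. -/
theorem map_ULoc_smul (φ : Module.End (U n) (Q n)) (x : ULoc n) (q : Q n) :
    φ (x • q) = x • φ q := by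
  obtain ⟨s, hs, r, h⟩ := exists_toULoc_mul_eq x
  rw [← (isUnit_toULoc hs).smul_left_cancel, ← mul_smul, h, toULoc_smul, toULoc_smul, ← map_smul,
    ← map_smul, ← toULoc_smul s, ← mul_smul, h, toULoc_smul]

/-! ### The isomorphism -/

/-- `u ↦ u (1 ⊗ 1)` is injective on `H_n`. -/
theorem eq_zero_of_smul_genQ {u : ULoc n} (hu : u ∈ H n) (h0 : u • genQ n = 0) : u = 0 := by
  -- The test group plays no role here, since the invariance clause is not needed.
  obtain ⟨P, hP1, hP2, -, -⟩ := exists_proj_H n ℤ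
  obtain ⟨s, hs, r, h⟩ := exists_toULoc_mul_eq u
  have hr : r • genQ n = 0 := by rw [← toULoc_smul, ← h, mul_smul, h0, smul_zero]
  have hker : ∀ r ∈ Submodule.span (U n) (Set.range fun i : Fin n => (partialU i - 1 : U n)),
      ∀ a : U n, P (toULoc n (a * r)) = 0 := by
    intro r hr
    induction hr using Submodule.span_induction with
    | mem x hx =>
      obtain ⟨i, rfl⟩ := hx
      intro a
      rw [mul_sub, mul_one, map_sub, map_sub, map_mul, ← val_partialUnit, hP1, sub_self]
    | zero => simp
    | add x y _ _ hx hy => intro a; rw [mul_add, map_add, map_add, hx, hy, add_zero]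
    | smul b x _ hx => intro a; rw [smul_eq_mul, ← mul_assoc, hx]
  have hPs : ∀ x, P (x * toULoc n s) = P x := by
    clear h
    induction hs using Submonoid.closure_induction with
    | mem y hy => obtain ⟨i, rfl⟩ := hy; exact hP1 i
    | one => simp
    | mul y z _ _ hy hz => intro x; rw [map_mul (toULoc n), ← mul_assoc, hz, hy]
  have h1 := hker r (mem_span_of_smul_genQ_eq_zero hr) 1
  rwa [one_mul, ← h, (commute_partialUnit_of_mem hs (mem_H_iff.1 hu).1).eq, hPs, hP2 u hu] at h1

/-- Every Whittaker vector of `Q_𝟏` comes from `H_n`. -/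
theorem exists_mem_H_smul_genQ {w : Q n} (hw : ∀ i, (partialU i : U n) • w = w) :
    ∃ u ∈ H n, u • genQ n = w := by
  obtain ⟨r, rfl⟩ := exists_smul_genQ w
  obtain ⟨x, hx, hxr⟩ := exists_forall_commute_smul_eq ℂ
    (p := fun i : Fin n => ((partialUnit i : (ULoc n)ˣ) : ULoc n)) (y := slice)
    commute_partialUnit adMap_slice (fun _ _ => commute_slice) ad_partialUnit_nilpotent
    partialUnit_smul_genQ (toULoc n r) (fun i => by
      rw [val_partialUnit, toULoc_smul, toULoc_smul, hw])
  obtain ⟨P, -, -, hP3, hP4⟩ := exists_proj_H n (Q n)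
  refine ⟨P x, hP3 x hx, ?_⟩
  rw [← toULoc_smul r, ← hxr]
  refine hP4 ((smulAddHom (ULoc n) (Q n)).flip (genQ n)) (fun i x => ?_) x
  change (x * _) • genQ n = x • genQ n
  rw [mul_smul, partialUnit_smul_genQ]

theorem partialU_smul_smul_genQ {u : ULoc n} (hu : u ∈ H n) (i : Fin n) :
    (partialU i : U n) • u • genQ n = u • genQ n := by
  rw [← toULoc_smul, ← val_partialUnit, ← mul_smul, ((mem_H_iff.1 hu).1 i).eq, mul_smul,
    partialUnit_smul_genQ]

/-- Right multiplication by `u ∈ H_n`, the endomorphism of `Q_𝟏` which maps `1 ⊗ 1` to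
`u (1 ⊗ 1)`. -/
def rightMulQ (u : H n) : Module.End (U n) (Q n) :=
  (exists_hom_genQ (partialU_smul_smul_genQ u.2)).choose

theorem rightMulQ_genQ (u : H n) : rightMulQ u (genQ n) = (u : ULoc n) • genQ n :=
  (exists_hom_genQ (partialU_smul_smul_genQ u.2)).choose_spec

/-- The homomorphism `H_n → End(Q_𝟏)ᵒᵖ` given by right multiplication. -/
def toEndQ (n : ℕ) : H n →ₐ[ℂ] (Module.End (U n) (Q n))ᵐᵒᵖ where
  toFun u := MulOpposite.op (rightMulQ u)
  map_one' := MulOpposite.unop_injective <| hom_ext_genQ <| by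
    simp [rightMulQ_genQ]
  map_mul' u v := MulOpposite.unop_injective <| hom_ext_genQ <| by
    rw [MulOpposite.unop_mul, MulOpposite.unop_op, MulOpposite.unop_op, MulOpposite.unop_op,
      Module.End.mul_apply, rightMulQ_genQ, rightMulQ_genQ, map_ULoc_smul, rightMulQ_genQ,
      ← mul_smul]
    rfl
  map_zero' := MulOpposite.unop_injective <| hom_ext_genQ <| by
    simp [rightMulQ_genQ]
  map_add' u v := MulOpposite.unop_injective <| hom_ext_genQ <| by
    simp [rightMulQ_genQ, add_smul]
  commutes' c := MulOpposite.unop_injective <| hom_ext_genQ <| by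
    rw [MulOpposite.unop_op, rightMulQ_genQ]
    change toULoc n (algebraMap ℂ (U n) c) • genQ n = c • genQ n
    rw [toULoc_smul, algebraMap_smul]

theorem bijective_toEndQ (n : ℕ) : Function.Bijective (toEndQ n) := by
  constructor
  · rw [injective_iff_map_eq_zero]
    intro u hu
    refine Subtype.ext (eq_zero_of_smul_genQ u.2 ?_)
    rw [← rightMulQ_genQ, show rightMulQ u = 0 from MulOpposite.op_injective hu,
      LinearMap.zero_apply]
  · intro φ
    obtain ⟨u, hu, h⟩ := exists_mem_H_smul_genQ (w := φ.unop (genQ n)) fun i => by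
      rw [← map_smul, partialU_smul_genQ]
    exact ⟨⟨u, hu⟩, MulOpposite.unop_injective (hom_ext_genQ ((rightMulQ_genQ _).trans h))⟩

end WittWhittaker

end

theorem theorem3p8 (n : ℕ) (hn : 0 < n) :
    Nonempty (WittWhittaker.H n ≃ₐ[ℂ] (Module.End (WittWhittaker.U n) (WittWhittaker.Q n))ᵐᵒᵖ) :=
  ⟨AlgEquiv.ofBijective (WittWhittaker.toEndQ n) (WittWhittaker.bijective_toEndQ n)⟩
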